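/- **Setting.** Let $r,c,n\in\mathbb N$, let $0<\bar t\le T$, let $\sigma,\tilde\sigma\in C^1(\mathbb R)$, and let $x,\hat x\in\mathbb R^{r\times c\times n}$. A matrix $K\in\mathbb R^{r\times r}$ acts on the first index of a tensor. A scalar bias $b$ is added to every entry. $\sigma,\tilde\sigma,\sigma',\tilde\sigma'$ act entrywise, $\odot$ is the entrywise product, $\langle\cdot,\cdot\rangle_F$ is the Frobenius inner product, and in a product $YZ^\intercal$ tensors are read as $r\times(cn)$ matrices. Consider the optimal control problem $$\min_\Theta\ J(x,g(T))+\mathcal R(\Theta),\qquad \Theta=(K,b,\tilde K,\tilde b),$$ $$d_tf=\sigma(Kf+b)\ \text{on }(0,\bar t],\quad f(0)=\hat x,\qquad d_tg=\tilde\sigma(\tilde Kg+\tilde b)\ \text{on }(\bar t,T],\quad g(\bar t)=f(\bar t),$$ with Lagrangian $$\mathcal L(f,g,\Theta;P,\tilde P)=J(x,g(T))+\mathcal R(\Theta)+\int_0^{\bar t}\langle d_tf-\sigma(Kf+b),P\rangle_F\,dt+\int_{\bar t}^T\langle d_tg-\tilde\sigma(\tilde Kg+\tilde b),\tilde P\rangle_F\,dt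 .$$ Call $(f,g)$ admissible if $f(0)=\hat x$ and $g(\bar t)=f(\bar t)$. The simplified Lagrangian, defined for unconstrained $(f,g)$, is $$\begin{aligned}\mathcal L_s(f,g,\Theta;P,\tilde P)=\;&J(x,g(T))+\mathcal R(\Theta)-\int_0^{\bar t}\langle d_tP,f\rangle_F\,dt+\langle P(\bar t),f(\bar t)\rangle_F-\langle P(0),\hat x\rangle_F-\int_0^{\bar t}\langle P,\sigma(Kf+b)\rangle_F\,dt\\&-\int_{\bar t}^T\langle d_t\tilde P,g\rangle_F\,dt+\langle\tilde P(T),g(T)\rangle_F-\langle\tilde P(\bar t),f(\bar t)\rangle_F-\int_{\bar t}^T\langle\tilde P,\tilde\sigma(\tilde Kg+\tilde b)\rangle_F\,dt .\end{aligned}$$ Let $f,P\in C^1([0,\bar t];\mathbb R^{r\times c\times n})$ and $g,\tilde P\in C^1([\bar t,T];\mathbb R^{r\times c\times n})$, and let $\Theta=(K,b,\tilde K,\tilde b)$ be continuous, with $K,b$ on $[0,\bar t]$ and $\tilde K,\tilde b$ on $[\bar t,T]$. Assume that $J(x,\cdot)$ is differentiable at $g(T)$. Gradients are taken in the sense of directional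 derivatives. "The gradient with respect to a group of variables vanishes" means that the derivative in every direction exists and is zero, where directions are $C^1$ for states and multipliers and continuous for $\Theta$. A gradient with respect to $\Theta$ of a functional $\Phi$ is a continuous $G=(G_K,G_b,G_{\tilde K},G_{\tilde b})$ such that the derivative of $\Phi$ at $\Theta$ in every continuous direction $\delta$ exists and equals $$\int_0^{\bar t}\big(\langle G_K,\delta_K\rangle_F+G_b\delta_b\big)dt+\int_{\bar t}^T\big(\langle G_{\tilde K},\delta_{\tilde K}\rangle_F+G_{\tilde b}\delta_{\tilde b}\big)dt .$$ Assume that $\mathcal R$ has such a gradient $(\nabla_K\mathcal R,\nabla_b\mathcal R,\nabla_{\tilde K}\mathcal R,\nabla_{\tilde b}\mathcal R)$ at $\Theta$. **Claim.** If $(f,g)$ is admissible, then $\mathcal L=\mathcal L_s$ at $(f,g,\Theta;P,\tilde P)$. Moreover, the following hold. **(A) State equations.** $\nabla_{(P,\tilde P)}\mathcal L_s=0$ at $(f,g,\Theta;P,\tilde P)$ if and only if $$d_tf=\sigma(Kf+b)\ \ \forall t\in(0,\bar t],\qquad f(0)=\hat x,\qquad d_tg=\tilde\sigma(\tilde Kg+\tilde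 b)\ \ \forall t\in(\bar t,T],\qquad g(\bar t)=f(\bar t).$$ The same system is equivalent to: $(f,g)$ is admissible and $\nabla_{(P,\tilde P)}\mathcal L=0$. **(B) Adjoint equations.** $\nabla_{(f,g)}\mathcal L_s=0$ at $(f,g,\Theta;P,\tilde P)$ if and only if $$-d_tP=K^\intercal\big(P\odot\sigma'(Kf+b)\big)\ \ \forall t\in[0,\bar t),\qquad P(\bar t)=\tilde P(\bar t),$$ $$-d_t\tilde P=\tilde K^\intercal\big(\tilde P\odot\tilde\sigma'(\tilde Kg+\tilde b)\big)\ \ \forall t\in[\bar t,T),\qquad \tilde P(T)=-\nabla_gJ(x,g(T)).$$ The same system is equivalent to: $\nabla_{(f,g)}\mathcal L=0$ along all directions $(\delta f,\delta g)$ with $\delta f(0)=0$ and $\delta g(\bar t)=\delta f(\bar t)$. If $\bar t=T$, this second equivalence is asserted under the convention $\tilde P(T)=P(T)$, since then $\mathcal L$ does not involve $\tilde P$. **(C) Gradient.** Both $\mathcal L$ and $\mathcal L_s$ have a gradient with respect to $\Theta$ at $(f,g,\Theta;P,\tilde P)$, and every such gradient satisfies, for each of them, $$\begin{aligned} \nabla_K\mathcal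 L&=-\big(P\odot\sigma'(Kf+b)\big)f^\intercal+\nabla_K\mathcal R, & t&\in(0,\bar t),\\ \nabla_b\mathcal L&=-\langle\sigma'(Kf+b),P\rangle_F+\nabla_b\mathcal R, & t&\in(0,\bar t),\\ \nabla_{\tilde K}\mathcal L&=-\big(\tilde P\odot\tilde\sigma'(\tilde Kg+\tilde b)\big)g^\intercal+\nabla_{\tilde K}\mathcal R, & t&\in(\bar t,T),\\ \nabla_{\tilde b}\mathcal L&=-\langle\tilde\sigma'(\tilde Kg+\tilde b),\tilde P\rangle_F+\nabla_{\tilde b}\mathcal R, & t&\in(\bar t,T). \end{aligned}$$ The gradient of $\mathcal L$ (or of $\mathcal L_s$) with respect to $\Theta$ vanishes if and only if the four right-hand sides vanish on these open intervals. Hence a stationary point satisfies the equations in (A) and (B), and the right-hand sides in (C) are zero there. -/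

import Mathlib

open Set

noncomputable section

namespace ContAE

/-- Data tensors in `ℝ^{r × c × n}`, with the Frobenius inner product `inner ℝ`. -/
abbrev Tensor (r c n : ℕ) := EuclideanSpace ℝ (Fin r × Fin c × Fin n)

/-- Square weight matrices. -/
abbrev Weight (r : ℕ) := Matrix (Fin r) (Fin r) ℝ

/-- Time-dependent tensors; only the values on the relevant time interval matter. -/
abbrev Path (r c n : ℕ) := ℝ → Tensor r c n

variable {r c n : ℕ}

/-- The product `K Y`: the matrix `K` acts on the first index of `Y`. -/
def act (K : Weight r) (Y : Tensor r c n) : Tensor r c n :=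
  WithLp.toLp 2 fun p => ∑ l, K p.1 l * Y (l, p.2)

/-- `K Y + b`, the scalar bias `b` being added to every entry. -/
def affine (K : Weight r) (b : ℝ) (Y : Tensor r c n) : Tensor r c n :=
  WithLp.toLp 2 fun p => act K Y p + b

/-- A scalar function applied to every entry. -/
def pointwise (φ : ℝ → ℝ) (Y : Tensor r c n) : Tensor r c n :=
  WithLp.toLp 2 fun p => φ (Y p)

/-- The Hadamard product `Y ⊙ Z`. -/
def hadamard (Y Z : Tensor r c n) : Tensor r c n :=
  WithLp.toLp 2 fun p => Y p * Z p

/-- The `r × r` matrix `Y Zᵀ`, where tensors are read as `r × (c n)` matrices. -/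
def mulTranspose (Y Z : Tensor r c n) : Weight r :=
  Matrix.of fun i l => ∑ q, Y (i, q) * Z (l, q)

/-- The Frobenius inner product of two matrices. -/
def frob (A B : Weight r) : ℝ := ∑ i, ∑ j, A i j * B i j

/-- Design variables: weight and bias `K, b` of the encoder, `Kd, bd` of the decoder. -/
structure Design (r : ℕ) where
  K : ℝ → Weight r
  b : ℝ → ℝ
  Kd : ℝ → Weight r
  bd : ℝ → ℝ

namespace Design

/-- `Θ + s δ`. -/
def perturb (Θ : Design r) (s : ℝ) (δ : Design r) : Design r where
  K := Θ.K + s • δ.K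
  b := Θ.b + s • δ.b
  Kd := Θ.Kd + s • δ.Kd
  bd := Θ.bd + s • δ.bd

/-- The zero design. -/
def zero (r : ℕ) : Design r where
  K := 0
  b := 0
  Kd := 0
  bd := 0

/-- Encoder variables are continuous on `[0, tbar]`, decoder variables on `[tbar, T]`. -/
def IsCont (tbar T : ℝ) (Θ : Design r) : Prop :=
  ContinuousOn Θ.K (Icc 0 tbar) ∧ ContinuousOn Θ.b (Icc 0 tbar) ∧
    ContinuousOn Θ.Kd (Icc tbar T) ∧ ContinuousOn Θ.bd (Icc tbar T)

/-- The `L²` pairing of two designs. -/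
def pairing (tbar T : ℝ) (G δ : Design r) : ℝ :=
  (∫ t in (0 : ℝ)..tbar, (frob (G.K t) (δ.K t) + G.b t * δ.b t)) +
    ∫ t in tbar..T, (frob (G.Kd t) (δ.Kd t) + G.bd t * δ.bd t)

end Design

/-- `G` is the continuous `L²`-gradient of the functional `Φ` at `Θ`: the derivative of `Φ` at `Θ`
in every continuous direction `δ` exists and is the `L²` pairing of `G` with `δ`. -/
def HasDesignGradient (tbar T : ℝ) (Φ : Design r → ℝ) (Θ G : Design r) : Prop :=
  G.IsCont tbar T ∧
    ∀ δ : Design r, δ.IsCont tbar T →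
      HasDerivAt (fun s : ℝ => Φ (Θ.perturb s δ)) (G.pairing tbar T δ) 0

/-- The data of the control problem: latent time, final time, activation functions of the encoder
and of the decoder, loss, regularizer, reference data and input data. -/
structure Problem (r c n : ℕ) where
  tbar : ℝ
  T : ℝ
  σ : ℝ → ℝ
  σd : ℝ → ℝ
  J : Tensor r c n → Tensor r c n → ℝ
  R : Design r → ℝ
  x : Tensor r c n
  xhat : Tensor r c n

/-- Functionals of `(f, g, Θ, P, Pd)`. -/
abbrev Functional (r c n : ℕ) :=
  Path r c n → Path r c n → Design r → Path r c n → Path r c n → ℝ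

namespace Problem

variable (p : Problem r c n)

/-- The cost `J(x, g(T)) + R(Θ)`. -/
def cost (Θ : Design r) (gT : Tensor r c n) : ℝ := p.J p.x gT + p.R Θ

/-- The encoder velocity `σ(K(t) f(t) + b(t))`. -/
def encVel (f : Path r c n) (Θ : Design r) (t : ℝ) : Tensor r c n :=
  pointwise p.σ (affine (Θ.K t) (Θ.b t) (f t))

/-- The decoder velocity `σ̃(K̃(t) g(t) + b̃(t))`. -/
def decVel (g : Path r c n) (Θ : Design r) (t : ℝ) : Tensor r c n :=
  pointwise p.σd (affine (Θ.Kd t) (Θ.bd t) (g t))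

/-- `σ'(K(t) f(t) + b(t))`. -/
def encVel' (f : Path r c n) (Θ : Design r) (t : ℝ) : Tensor r c n :=
  pointwise (deriv p.σ) (affine (Θ.K t) (Θ.b t) (f t))

/-- `σ̃'(K̃(t) g(t) + b̃(t))`. -/
def decVel' (g : Path r c n) (Θ : Design r) (t : ℝ) : Tensor r c n :=
  pointwise (deriv p.σd) (affine (Θ.Kd t) (Θ.bd t) (g t))

/-- The Lagrangian. Its state arguments are meant to satisfy `IsAdmissible` below. -/
def lagrangian : Functional r c n := fun f g Θ P Pd =>
  p.cost Θ (g p.T)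
    + (∫ t in (0 : ℝ)..p.tbar,
        inner ℝ (derivWithin f (Icc 0 p.tbar) t - p.encVel f Θ t) (P t))
    + ∫ t in p.tbar..p.T,
        inner ℝ (derivWithin g (Icc p.tbar p.T) t - p.decVel g Θ t) (Pd t)

/-- The Lagrangian after integration by parts, with `f(0) = xhat` and `g(tbar) = f(tbar)`
inserted; here the state arguments are unconstrained. -/
def simplifiedLagrangian : Functional r c n := fun f g Θ P Pd =>
  p.cost Θ (g p.T)
    - (∫ t in (0 : ℝ)..p.tbar, inner ℝ (derivWithin P (Icc 0 p.tbar) t) (f t))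
    + inner ℝ (P p.tbar) (f p.tbar)
    - inner ℝ (P 0) p.xhat
    - (∫ t in (0 : ℝ)..p.tbar, inner ℝ (P t) (p.encVel f Θ t))
    - (∫ t in p.tbar..p.T, inner ℝ (derivWithin Pd (Icc p.tbar p.T) t) (g t))
    + inner ℝ (Pd p.T) (g p.T)
    - inner ℝ (Pd p.tbar) (f p.tbar)
    - ∫ t in p.tbar..p.T, inner ℝ (Pd t) (p.decVel g Θ t)

/-- The initial condition and the coupling condition. -/
def IsAdmissible (f g : Path r c n) : Prop :=
  f 0 = p.xhat ∧ g p.tbar = f p.tbar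

/-- `u` is continuously differentiable on `[0, tbar]` and `v` on `[tbar, T]`. -/
def IsC1Pair (u v : Path r c n) : Prop :=
  ContDiffOn ℝ 1 u (Icc 0 p.tbar) ∧ ContDiffOn ℝ 1 v (Icc p.tbar p.T)

/-- The gradient of `L` with respect to the multipliers vanishes. -/
def MultiplierStationary (L : Functional r c n) (f g : Path r c n) (Θ : Design r)
    (P Pd : Path r c n) : Prop :=
  ∀ δP δPd : Path r c n, p.IsC1Pair δP δPd →
    HasDerivAt (fun s : ℝ => L f g Θ (P + s • δP) (Pd + s • δPd)) 0 0

/-- The gradient of `L` with respect to unconstrained states vanishes. -/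
def StateStationary (L : Functional r c n) (f g : Path r c n) (Θ : Design r)
    (P Pd : Path r c n) : Prop :=
  ∀ δf δg : Path r c n, p.IsC1Pair δf δg →
    HasDerivAt (fun s : ℝ => L (f + s • δf) (g + s • δg) Θ P Pd) 0 0

/-- The gradient of `L` with respect to the states vanishes along all variations that preserve the
initial condition and the coupling condition. -/
def ConstrainedStateStationary (L : Functional r c n) (f g : Path r c n) (Θ : Design r)
    (P Pd : Path r c n) : Prop :=
  ∀ δf δg : Path r c n, p.IsC1Pair δf δg → δf 0 = 0 → δg p.tbar = δf p.tbar →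
    HasDerivAt (fun s : ℝ => L (f + s • δf) (g + s • δg) Θ P Pd) 0 0

/-- The gradient of `L` with respect to the design variables vanishes. -/
def DesignStationary (L : Functional r c n) (f g : Path r c n) (Θ : Design r)
    (P Pd : Path r c n) : Prop :=
  ∀ δ : Design r, δ.IsCont p.tbar p.T →
    HasDerivAt (fun s : ℝ => L f g (Θ.perturb s δ) P Pd) 0 0

/-- The state equations (forward propagation). -/
def StateEq (f g : Path r c n) (Θ : Design r) : Prop :=
  (∀ t ∈ Ioc 0 p.tbar, HasDerivWithinAt f (p.encVel f Θ t) (Icc 0 p.tbar) t) ∧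
  f 0 = p.xhat ∧
  (∀ t ∈ Ioc p.tbar p.T, HasDerivWithinAt g (p.decVel g Θ t) (Icc p.tbar p.T) t) ∧
  g p.tbar = f p.tbar

/-- The adjoint equations (backward propagation). -/
def AdjointEq (f g : Path r c n) (Θ : Design r) (P Pd : Path r c n) : Prop :=
  (∀ t ∈ Ico 0 p.tbar,
    HasDerivWithinAt P (-(act (Θ.K t).transpose (hadamard (P t) (p.encVel' f Θ t))))
      (Icc 0 p.tbar) t) ∧
  P p.tbar = Pd p.tbar ∧
  (∀ t ∈ Ico p.tbar p.T,
    HasDerivWithinAt Pd (-(act (Θ.Kd t).transpose (hadamard (Pd t) (p.decVel' g Θ t))))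
      (Icc p.tbar p.T) t) ∧
  Pd p.T = -gradient (p.J p.x) (g p.T)

/-- The design equations: `G` is the design gradient of the Lagrangian, computed from the states,
the multipliers and the gradient `ρ` of the regularizer. -/
def DesignEq (f g : Path r c n) (Θ : Design r) (P Pd : Path r c n) (ρ G : Design r) : Prop :=
  (∀ t ∈ Ioo 0 p.tbar,
    G.K t = -mulTranspose (hadamard (P t) (p.encVel' f Θ t)) (f t) + ρ.K t) ∧
  (∀ t ∈ Ioo 0 p.tbar, G.b t = -inner ℝ (p.encVel' f Θ t) (P t) + ρ.b t) ∧
  (∀ t ∈ Ioo p.tbar p.T,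
    G.Kd t = -mulTranspose (hadamard (Pd t) (p.decVel' g Θ t)) (g t) + ρ.Kd t) ∧
  (∀ t ∈ Ioo p.tbar p.T, G.bd t = -inner ℝ (p.decVel' g Θ t) (Pd t) + ρ.bd t)

end Problem

end ContAE

end

/-!
Integration by parts in both phases turns the Lagrangian into the simplified one, up to the
multipliers tested against the violation of `f 0 = xhat` and of `g tbar = f tbar`:
`Problem.lagrangian_eq`. This correction vanishes for admissible states, is constant along
variations of the states that preserve the two conditions, and does not depend on the design, so
every assertion about the Lagrangian reduces to one about the simplified Lagrangian.

The simplified Lagrangian is affine in the multipliers, and its first variation is the residual of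
the state equations tested against the direction, plus two boundary terms. In the states and in the
design, the only nonlinear terms besides the loss and the regularizer are the velocities; they are
differentiated under the integral sign
(`hasDerivAt_integral_inner_pointwise`), and moving the weight matrix to the other side of the
Frobenius product gives the residual of the adjoint equations (`Problem.stateVariation`) and the
design gradient (`Problem.designGradient`).

Conversely, test directions that vanish at both ends of a phase give the differential equations by
the fundamental lemma of the calculus of variations (`hasDerivWithinAt_of_weak`), which holds on the
closed interval since all data are continuous. Then only boundary terms are left, and constant or
affine directions separate them. When `tbar = T`, the decoder phase is a single point: its integrals
vanish and its differential equations are void. Design gradients are unique on the open intervals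
because the difference of two of them is itself an admissible direction, whose square has integral
zero.
-/

namespace ContAE

/-! ### Calculus on a compact interval -/

section Calculus

open MeasureTheory

variable {E : Type*} [NormedAddCommGroup E] [InnerProductSpace ℝ E] {a b : ℝ}

theorem continuousOn_derivWithin_Icc {u : ℝ → E} (hab : a ≤ b)
    (hu : ContDiffOn ℝ 1 u (Icc a b)) : ContinuousOn (derivWithin u (Icc a b)) (Icc a b) := by
  rcases hab.eq_or_lt with rfl | hlt
  · simp
  exact hu.continuousOn_derivWithin (uniqueDiffOn_Icc hlt) le_rfl

/-- Integration by parts. -/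
theorem integral_inner_derivWithin (hab : a ≤ b) {u v : ℝ → E}
    (hu : ContDiffOn ℝ 1 u (Icc a b)) (hv : ContDiffOn ℝ 1 v (Icc a b)) :
    ∫ t in a..b, inner ℝ (derivWithin u (Icc a b) t) (v t) =
      inner ℝ (u b) (v b) - inner ℝ (u a) (v a)
        - ∫ t in a..b, inner ℝ (derivWithin v (Icc a b) t) (u t) := by
  rcases hab.eq_or_lt with rfl | hlt
  · simp
  have h1 : ContinuousOn (fun t => inner ℝ (derivWithin u (Icc a b) t) (v t)) (Icc a b) :=
    (continuousOn_derivWithin_Icc hab hu).inner hv.continuousOn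
  have h2 : ContinuousOn (fun t => inner ℝ (derivWithin v (Icc a b) t) (u t)) (Icc a b) :=
    (continuousOn_derivWithin_Icc hab hv).inner hu.continuousOn
  have i1 := h1.intervalIntegrable_of_Icc (μ := volume) hab
  have i2 := h2.intervalIntegrable_of_Icc (μ := volume) hab
  rw [eq_sub_iff_add_eq, ← intervalIntegral.integral_add i1 i2]
  refine intervalIntegral.integral_eq_sub_of_hasDerivAt_of_le
    (f := fun t => inner ℝ (u t) (v t)) hab (hu.continuousOn.inner hv.continuousOn) ?_ (i1.add i2)
  intro t ht
  have hn : Icc a b ∈ nhds t := Icc_mem_nhds ht.1 ht.2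
  have hd : ∀ w : ℝ → E, ContDiffOn ℝ 1 w (Icc a b) →
      HasDerivAt w (derivWithin w (Icc a b) t) t := fun w hw =>
    ((hw.differentiableOn one_ne_zero t (Ioo_subset_Icc_self ht)).hasDerivWithinAt).hasDerivAt hn
  convert! (hd u hu).inner ℝ (hd v hv) using 1
  rw [real_inner_comm (u t), add_comm]

/-- The fundamental lemma of the calculus of variations, for test functions that vanish at both
end points; by continuity, the conclusion includes the end points. -/
theorem eqOn_zero_of_integral_inner_eq_zero [CompleteSpace E] (hab : a < b) {h : ℝ → E}
    (hh : ContinuousOn h (Icc a b))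
    (H : ∀ φ : ℝ → E, ContDiff ℝ 1 φ → φ a = 0 → φ b = 0 → ∫ t in a..b, inner ℝ (h t) (φ t) = 0) :
    ∀ t ∈ Icc a b, h t = 0 := by
  have key : ∀ᵐ t ∂volume, t ∈ Ioo a b → h t = 0 := by
    refine isOpen_Ioo.ae_eq_zero_of_integral_contDiff_smul_eq_zero
      ((hh.mono Ioo_subset_Icc_self).locallyIntegrableOn measurableSet_Ioo) ?_
    intro φ hφ _ hsupp
    have hz : ∀ t, t ∉ Ioo a b → φ t = 0 := fun t ht =>
      image_eq_zero_of_notMem_tsupport fun h' => ht (hsupp h')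
    have hφ1 : ContDiff ℝ 1 φ := hφ.of_le (by exact_mod_cast le_top)
    have hint : IntervalIntegrable (fun t => φ t • h t) volume a b :=
      (hφ1.continuous.continuousOn.smul hh).intervalIntegrable_of_Icc hab.le
    have hset : ∫ t, φ t • h t = ∫ t in a..b, φ t • h t := by
      rw [intervalIntegral.integral_of_le hab.le, setIntegral_eq_integral_of_forall_compl_eq_zero]
      intro t ht
      rw [hz t fun h' => ht (Ioo_subset_Ioc_self h'), zero_smul]
    -- Testing with `φ • v` for each vector `v` shows that the vector integral is zero.
    rw [hset]
    refine ext_inner_left ℝ fun v => ?_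
    rw [inner_zero_right, intervalIntegral.integral_of_le hab.le,
      ← integral_inner ((intervalIntegrable_iff_integrableOn_Ioc_of_le hab.le).1 hint),
      ← intervalIntegral.integral_of_le hab.le]
    rw [← H (fun t => φ t • v) (hφ1.smul contDiff_const) (by simp [hz a]) (by simp [hz b])]
    refine intervalIntegral.integral_congr fun t _ => ?_
    simp only [real_inner_smul_right, real_inner_comm v]
  have hIoo : EqOn h 0 (Ioo a b) :=
    Measure.eqOn_Ioo_of_ae_eq (μ := volume) ((ae_restrict_iff' measurableSet_Ioo).2 key)
      (hh.mono Ioo_subset_Icc_self) continuousOn_const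
  exact hIoo.of_subset_closure hh continuousOn_const Ioo_subset_Icc_self
    (closure_Ioo hab.ne).symm.subset

theorem eqOn_zero_of_integral_eq_zero_of_nonneg (hab : a < b) {h : ℝ → ℝ}
    (hh : ContinuousOn h (Icc a b)) (h0 : ∀ t, 0 ≤ h t) (hI : ∫ t in a..b, h t = 0) :
    ∀ t ∈ Icc a b, h t = 0 := by
  intro t ht
  by_contra hne
  exact (intervalIntegral.integral_pos hab hh (fun x _ => h0 x)
    ⟨t, ht, (h0 t).lt_of_ne' hne⟩).ne' hI

/-- A weak solution of `u' = w` in the class of `C¹` functions is a classical one. -/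
theorem hasDerivWithinAt_of_weak [CompleteSpace E] (hab : a < b) {u w : ℝ → E}
    (hu : ContDiffOn ℝ 1 u (Icc a b)) (hw : ContinuousOn w (Icc a b))
    (H : ∀ φ : ℝ → E, ContDiff ℝ 1 φ → φ a = 0 → φ b = 0 →
      ∫ t in a..b, inner ℝ (derivWithin u (Icc a b) t - w t) (φ t) = 0) :
    ∀ t ∈ Icc a b, HasDerivWithinAt u (w t) (Icc a b) t := by
  intro t ht
  have := eqOn_zero_of_integral_inner_eq_zero hab
    ((continuousOn_derivWithin_Icc hab.le hu).sub hw) H t ht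
  rw [← sub_eq_zero.1 this]
  exact (hu.differentiableOn one_ne_zero t ht).hasDerivWithinAt

theorem integral_congr_Ioo {F : Type*} [NormedAddCommGroup F] [NormedSpace ℝ F] {h k : ℝ → F}
    (hab : a ≤ b) (H : ∀ t ∈ Ioo a b, h t = k t) : ∫ t in a..b, h t = ∫ t in a..b, k t := by
  rw [intervalIntegral.integral_of_le hab, intervalIntegral.integral_of_le hab,
    integral_Ioc_eq_integral_Ioo, integral_Ioc_eq_integral_Ioo]
  exact setIntegral_congr_fun measurableSet_Ioo H

theorem integral_inner_derivWithin_sub_eq_zero (hab : a ≤ b) {u w : ℝ → E}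
    (H : ∀ t ∈ Ioo a b, HasDerivWithinAt u (w t) (Icc a b) t) (φ : ℝ → E) :
    ∫ t in a..b, inner ℝ (derivWithin u (Icc a b) t - w t) (φ t) = 0 := by
  rcases hab.eq_or_lt with rfl | hlt
  · simp
  rw [integral_congr_Ioo (k := fun _ => (0 : ℝ)) hab, intervalIntegral.integral_zero]
  intro t ht
  rw [(H t ht).derivWithin (uniqueDiffOn_Icc hlt t (Ioo_subset_Icc_self ht)), sub_self,
    inner_zero_left]

/-- Integration by parts in the weak form of `u' = w` with multiplier `v`. -/
theorem integral_inner_sub_eq (hab : a ≤ b) {u v w : ℝ → E} (hu : ContDiffOn ℝ 1 u (Icc a b))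
    (hv : ContDiffOn ℝ 1 v (Icc a b)) (hw : ContinuousOn w (Icc a b)) :
    ∫ t in a..b, inner ℝ (derivWithin u (Icc a b) t - w t) (v t) =
      inner ℝ (v b) (u b) - inner ℝ (v a) (u a)
        - (∫ t in a..b, inner ℝ (derivWithin v (Icc a b) t) (u t))
        - ∫ t in a..b, inner ℝ (v t) (w t) := by
  have i1 := ((continuousOn_derivWithin_Icc hab hu).inner (𝕜 := ℝ)
    hv.continuousOn).intervalIntegrable_of_Icc (μ := volume) hab
  have i2 := (hv.continuousOn.inner (𝕜 := ℝ) hw).intervalIntegrable_of_Icc (μ := volume) hab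
  simp only [inner_sub_left, real_inner_comm (v _) (w _)]
  rw [intervalIntegral.integral_sub i1 i2, integral_inner_derivWithin hab hu hv,
    real_inner_comm (v b), real_inner_comm (v a)]

theorem hasDerivAt_integral_inner_add_smul (hab : a ≤ b) {h u v : ℝ → E}
    (hh : ContinuousOn h (Icc a b)) (hu : ContinuousOn u (Icc a b))
    (hv : ContinuousOn v (Icc a b)) :
    HasDerivAt (fun s : ℝ => ∫ t in a..b, inner ℝ (h t) ((u + s • v) t))
      (∫ t in a..b, inner ℝ (h t) (v t)) 0 := by
  have i1 := (hh.inner (𝕜 := ℝ) hu).intervalIntegrable_of_Icc (μ := volume) hab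
  have i2 := (hh.inner (𝕜 := ℝ) hv).intervalIntegrable_of_Icc (μ := volume) hab
  have : (fun s : ℝ => ∫ t in a..b, inner ℝ (h t) ((u + s • v) t)) = fun s : ℝ =>
      (∫ t in a..b, inner ℝ (h t) (u t)) + s * ∫ t in a..b, inner ℝ (h t) (v t) := by
    funext s
    simp only [Pi.add_apply, Pi.smul_apply, inner_add_right, real_inner_smul_right]
    rw [intervalIntegral.integral_add i1 (i2.const_mul s), intervalIntegral.integral_const_mul]
  rw [this]
  simpa using ((hasDerivAt_id (0 : ℝ)).mul_const
    (∫ t in a..b, inner ℝ (h t) (v t))).const_add (∫ t in a..b, inner ℝ (h t) (u t))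

theorem hasDerivAt_inner_add_smul (x y z : E) :
    HasDerivAt (fun s : ℝ => inner ℝ x (y + s • z)) (inner ℝ x z) 0 := by
  simp only [inner_add_right, real_inner_smul_right]
  simpa using ((hasDerivAt_id (0 : ℝ)).mul_const (inner ℝ x z)).const_add (inner ℝ x y)

/-- Differentiation of `s ↦ ∫ q φ(u + s v)` at `s = 0` under the integral sign. -/
theorem hasDerivAt_integral_mul_comp (hab : a ≤ b) {φ : ℝ → ℝ} (hφ : ContDiff ℝ 1 φ)
    {q u v : ℝ → ℝ} (hq : ContinuousOn q (Icc a b)) (hu : ContinuousOn u (Icc a b))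
    (hv : ContinuousOn v (Icc a b)) :
    HasDerivAt (fun s : ℝ => ∫ t in a..b, q t * φ (u t + s * v t))
      (∫ t in a..b, q t * (deriv φ (u t) * v t)) 0 := by
  have hφ' : Continuous (deriv φ) := hφ.continuous_deriv le_rfl
  have huIoc : uIoc a b ⊆ Icc a b := by
    rw [uIoc_of_le hab]; exact Ioc_subset_Icc_self
  have hF : ∀ s : ℝ, ContinuousOn (fun t => q t * φ (u t + s * v t)) (Icc a b) := fun s =>
    hq.mul (hφ.continuous.comp_continuousOn (hu.add (continuousOn_const.mul hv)))
  have hF' : ContinuousOn (fun t => q t * (deriv φ (u t + 0 * v t) * v t)) (Icc a b) :=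
    hq.mul ((hφ'.comp_continuousOn (hu.add (continuousOn_const.mul hv))).mul hv)
  -- The derivative is jointly continuous on a compact rectangle, hence bounded there.
  obtain ⟨C, hC⟩ : ∃ C, ∀ z ∈ Icc (-1 : ℝ) 1 ×ˢ Icc a b,
      ‖q z.2 * (deriv φ (u z.2 + z.1 * v z.2) * v z.2)‖ ≤ C := by
    refine (isCompact_Icc.prod isCompact_Icc).exists_bound_of_continuousOn ?_
    have hs : MapsTo (Prod.snd : ℝ × ℝ → ℝ) (Icc (-1 : ℝ) 1 ×ˢ Icc a b) (Icc a b) :=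
      fun z hz => hz.2
    have hq2 := hq.comp continuousOn_snd hs
    have hu2 := hu.comp continuousOn_snd hs
    have hv2 := hv.comp continuousOn_snd hs
    exact hq2.mul ((hφ'.comp_continuousOn (hu2.add (continuousOn_fst.mul hv2))).mul hv2)
  have := (intervalIntegral.hasDerivAt_integral_of_dominated_loc_of_deriv_le (μ := volume)
    (F := fun s t => q t * φ (u t + s * v t))
    (F' := fun s t => q t * (deriv φ (u t + s * v t) * v t)) (x₀ := (0 : ℝ))
    (bound := fun _ => C) (a := a) (b := b)
    (Icc_mem_nhds (by norm_num : (-1 : ℝ) < 0) (by norm_num : (0 : ℝ) < 1))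
    (Filter.Eventually.of_forall fun s =>
      ((hF s).mono huIoc).aestronglyMeasurable measurableSet_uIoc)
    ((hF 0).intervalIntegrable_of_Icc hab)
    ((hF'.mono huIoc).aestronglyMeasurable measurableSet_uIoc)
    (Filter.Eventually.of_forall fun t ht s hs => hC (s, t) ⟨hs, huIoc ht⟩)
    intervalIntegrable_const ?_).2
  · simpa using this
  refine Filter.Eventually.of_forall fun t _ s _ => ?_
  have h1 : HasDerivAt (fun s : ℝ => u t + s * v t) (v t) s := by
    simpa using ((hasDerivAt_id s).mul_const (v t)).const_add (u t)
  exact ((hφ.differentiable one_ne_zero _).hasDerivAt.comp s h1).const_mul (q t)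

end Calculus

/-! ### Tensor algebra and continuity of tensor-valued paths -/

section Tensors

variable {r c n : ℕ}

theorem inner_tensor (Y Z : Tensor r c n) : inner ℝ Y Z = ∑ q, Y q * Z q := by
  simp only [PiLp.inner_apply, RCLike.inner_apply, conj_trivial, mul_comm]

theorem affine_add_smul (K : Weight r) (b s : ℝ) (Y W : Tensor r c n) :
    affine K b (Y + s • W) = affine K b Y + s • act K W := by
  ext q
  simp only [affine, act, PiLp.add_apply, PiLp.smul_apply, smul_eq_mul, mul_add,
    Finset.sum_add_distrib, Finset.mul_sum, mul_left_comm s]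
  ring

/-- The affine map is linear in weight and bias together, so that a design perturbation perturbs its
value by an expression of the same form. -/
theorem affine_perturb (K M : Weight r) (b β s : ℝ) (Y : Tensor r c n) :
    affine (K + s • M) (b + s * β) Y = affine K b Y + s • affine M β Y := by
  ext q
  simp only [affine, act, PiLp.add_apply, PiLp.smul_apply, Matrix.add_apply, Matrix.smul_apply,
    smul_eq_mul, add_mul, Finset.sum_add_distrib, mul_add, Finset.mul_sum, mul_assoc]
  ring

/-- The adjoint of the action of `K` is the action of the transpose. -/
theorem inner_act_right (K : Weight r) (Z Y : Tensor r c n) :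
    inner ℝ Z (act K Y) = inner ℝ (act K.transpose Z) Y := by
  simp only [inner_tensor, act, Fintype.sum_prod_type (α₁ := Fin r), Finset.mul_sum,
    Finset.sum_mul, Matrix.transpose_apply]
  rw [Finset.sum_congr rfl fun i _ => Finset.sum_comm, Finset.sum_comm]
  refine Finset.sum_congr rfl fun l _ => ?_
  rw [Finset.sum_comm]
  exact Finset.sum_congr rfl fun q _ => Finset.sum_congr rfl fun i _ => by ring

/-- The adjoint of `(M, β) ↦ M Y + β`: this is where the products `Z Yᵀ` in the design gradient come
from. -/
theorem inner_affine_right (M : Weight r) (β : ℝ) (Z Y : Tensor r c n) :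
    inner ℝ Z (affine M β Y) = frob (mulTranspose Z Y) M + (∑ q, Z q) * β := by
  have h : inner ℝ Z (act M Y) = frob (mulTranspose Z Y) M := by
    simp only [inner_tensor, act, frob, mulTranspose, Matrix.of_apply,
      Fintype.sum_prod_type (α₁ := Fin r), Finset.mul_sum, Finset.sum_mul]
    refine Finset.sum_congr rfl fun i _ => ?_
    rw [Finset.sum_comm]
    exact Finset.sum_congr rfl fun q _ => Finset.sum_congr rfl fun i _ => by ring
  rw [← h]
  simp only [inner_tensor, affine, mul_add, Finset.sum_add_distrib, Finset.sum_mul]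

theorem sum_hadamard (Y Z : Tensor r c n) : ∑ q, hadamard Y Z q = inner ℝ Z Y := by
  simp only [inner_tensor, hadamard, mul_comm]

theorem frob_self_nonneg (A : Weight r) : 0 ≤ frob A A :=
  Finset.sum_nonneg fun _ _ => Finset.sum_nonneg fun _ _ => mul_self_nonneg _

theorem eq_zero_of_frob_self {A : Weight r} (h : frob A A = 0) : A = 0 := by
  ext i j
  have h1 := (Finset.sum_eq_zero_iff_of_nonneg fun i _ =>
    Finset.sum_nonneg fun _ _ => mul_self_nonneg _).1 h i (Finset.mem_univ i)
  have h2 := (Finset.sum_eq_zero_iff_of_nonneg fun _ _ => mul_self_nonneg _).1 h1 j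
    (Finset.mem_univ j)
  exact mul_self_eq_zero.1 h2

theorem frob_add_left (A B C : Weight r) : frob (A + B) C = frob A C + frob B C := by
  simp only [frob, Matrix.add_apply, add_mul, Finset.sum_add_distrib]

theorem frob_neg_left (A C : Weight r) : frob (-A) C = -frob A C := by
  simp only [frob, Matrix.neg_apply, neg_mul, Finset.sum_neg_distrib]

theorem frob_sub_left (A B C : Weight r) : frob (A - B) C = frob A C - frob B C := by
  rw [sub_eq_add_neg, frob_add_left, frob_neg_left, sub_eq_add_neg]

variable {S : Set ℝ}

theorem continuousOn_tensor {A : Path r c n} :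
    ContinuousOn A S ↔ ∀ q, ContinuousOn (fun t => A t q) S :=
  ⟨fun h q => (PiLp.continuous_apply 2 _ q).comp_continuousOn h,
    fun h => (PiLp.continuous_toLp 2 _).comp_continuousOn (continuousOn_pi.2 h)⟩

theorem continuousOn_weight {A : ℝ → Weight r} :
    ContinuousOn A S ↔ ∀ i j, ContinuousOn (fun t => A t i j) S :=
  ⟨fun h i j => (continuous_id.matrix_elem i j).comp_continuousOn h,
    fun h => continuousOn_pi.2 fun i => continuousOn_pi.2 fun j => h i j⟩

theorem continuousOn_act {K : ℝ → Weight r} {Y : Path r c n} (hK : ContinuousOn K S)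
    (hY : ContinuousOn Y S) : ContinuousOn (fun t => act (K t) (Y t)) S :=
  continuousOn_tensor.2 fun q => continuousOn_finsetSum Finset.univ fun l _ =>
    (continuousOn_weight.1 hK q.1 l).mul (continuousOn_tensor.1 hY (l, q.2))

theorem continuousOn_affine {K : ℝ → Weight r} {b : ℝ → ℝ} {Y : Path r c n}
    (hK : ContinuousOn K S) (hb : ContinuousOn b S) (hY : ContinuousOn Y S) :
    ContinuousOn (fun t => affine (K t) (b t) (Y t)) S :=
  continuousOn_tensor.2 fun q => (continuousOn_tensor.1 (continuousOn_act hK hY) q).add hb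

theorem continuousOn_pointwise {φ : ℝ → ℝ} {Y : Path r c n} (hφ : Continuous φ)
    (hY : ContinuousOn Y S) : ContinuousOn (fun t => pointwise φ (Y t)) S :=
  continuousOn_tensor.2 fun q => hφ.comp_continuousOn (continuousOn_tensor.1 hY q)

theorem continuousOn_hadamard {Y Z : Path r c n} (hY : ContinuousOn Y S)
    (hZ : ContinuousOn Z S) : ContinuousOn (fun t => hadamard (Y t) (Z t)) S :=
  continuousOn_tensor.2 fun q => (continuousOn_tensor.1 hY q).mul (continuousOn_tensor.1 hZ q)

theorem continuousOn_mulTranspose {Y Z : Path r c n} (hY : ContinuousOn Y S)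
    (hZ : ContinuousOn Z S) : ContinuousOn (fun t => mulTranspose (Y t) (Z t)) S :=
  continuousOn_weight.2 fun i l => continuousOn_finsetSum _ fun q _ =>
    (continuousOn_tensor.1 hY (i, q)).mul (continuousOn_tensor.1 hZ (l, q))

theorem continuousOn_frob {A B : ℝ → Weight r} (hA : ContinuousOn A S) (hB : ContinuousOn B S) :
    ContinuousOn (fun t => frob (A t) (B t)) S :=
  continuousOn_finsetSum _ fun i _ => continuousOn_finsetSum _ fun j _ =>
    (continuousOn_weight.1 hA i j).mul (continuousOn_weight.1 hB i j)

theorem continuousOn_transpose {K : ℝ → Weight r} (hK : ContinuousOn K S) :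
    ContinuousOn (fun t => (K t).transpose) S :=
  continuousOn_weight.2 fun i j => continuousOn_weight.1 hK j i

end Tensors

/-! ### First variations of the velocity terms -/

section Velocity

variable {r c n : ℕ} {a e : ℝ} {φ : ℝ → ℝ}

theorem hasDerivAt_integral_inner_pointwise (hae : a ≤ e) (hφ : ContDiff ℝ 1 φ)
    {Q A B : Path r c n} (hQ : ContinuousOn Q (Icc a e)) (hA : ContinuousOn A (Icc a e))
    (hB : ContinuousOn B (Icc a e)) :
    HasDerivAt (fun s : ℝ => ∫ t in a..e, inner ℝ (Q t) (pointwise φ (A t + s • B t)))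
      (∫ t in a..e, inner ℝ (hadamard (Q t) (pointwise (deriv φ) (A t))) (B t)) 0 := by
  have hQ' := continuousOn_tensor.1 hQ
  have hA' := continuousOn_tensor.1 hA
  have hB' := continuousOn_tensor.1 hB
  have hsum := HasDerivAt.fun_sum (u := Finset.univ) fun q _ =>
    hasDerivAt_integral_mul_comp hae hφ (hQ' q) (hA' q) (hB' q)
  convert! hsum using 1
  · funext s
    rw [← intervalIntegral.integral_finsetSum]
    · simp only [inner_tensor, pointwise, PiLp.add_apply, PiLp.smul_apply, smul_eq_mul]
    · exact fun q _ => ((hQ' q).mul (hφ.continuous.comp_continuousOn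
        ((hA' q).add (continuousOn_const.mul (hB' q))))).intervalIntegrable_of_Icc hae
  · rw [← intervalIntegral.integral_finsetSum]
    · simp only [inner_tensor, hadamard, pointwise, mul_assoc]
    · exact fun q _ => ((hQ' q).mul (((hφ.continuous_deriv le_rfl).comp_continuousOn
        (hA' q)).mul (hB' q))).intervalIntegrable_of_Icc hae

variable {K M : ℝ → Weight r} {b β : ℝ → ℝ} {P f δ : Path r c n}

theorem hasDerivAt_integral_velocity_state (hae : a ≤ e) (hφ : ContDiff ℝ 1 φ)
    (hK : ContinuousOn K (Icc a e)) (hb : ContinuousOn b (Icc a e))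
    (hP : ContinuousOn P (Icc a e)) (hf : ContinuousOn f (Icc a e))
    (hδ : ContinuousOn δ (Icc a e)) :
    HasDerivAt
      (fun s : ℝ => ∫ t in a..e, inner ℝ (P t) (pointwise φ (affine (K t) (b t) ((f + s • δ) t))))
      (∫ t in a..e, inner ℝ (act (K t).transpose
        (hadamard (P t) (pointwise (deriv φ) (affine (K t) (b t) (f t))))) (δ t)) 0 := by
  simp only [Pi.add_apply, Pi.smul_apply, affine_add_smul, ← inner_act_right]
  exact hasDerivAt_integral_inner_pointwise hae hφ hP (continuousOn_affine hK hb hf)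
    (continuousOn_act hK hδ)

theorem hasDerivAt_integral_velocity_design (hae : a ≤ e) (hφ : ContDiff ℝ 1 φ)
    (hK : ContinuousOn K (Icc a e)) (hb : ContinuousOn b (Icc a e))
    (hM : ContinuousOn M (Icc a e)) (hβ : ContinuousOn β (Icc a e))
    (hP : ContinuousOn P (Icc a e)) (hf : ContinuousOn f (Icc a e)) :
    HasDerivAt
      (fun s : ℝ => ∫ t in a..e,
        inner ℝ (P t) (pointwise φ (affine ((K + s • M) t) ((b + s • β) t) (f t))))
      (∫ t in a..e,
        (frob (mulTranspose (hadamard (P t) (pointwise (deriv φ) (affine (K t) (b t) (f t))))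
          (f t)) (M t)
        + inner ℝ (pointwise (deriv φ) (affine (K t) (b t) (f t))) (P t) * β t)) 0 := by
  simp only [Pi.add_apply, Pi.smul_apply, smul_eq_mul, affine_perturb, ← sum_hadamard,
    ← inner_affine_right]
  exact hasDerivAt_integral_inner_pointwise hae hφ hP (continuousOn_affine hK hb hf)
    (continuousOn_affine hM hβ hf)

end Velocity

/-! ### Design gradients -/

section DesignGradient

variable {r : ℕ} {tbar T : ℝ}

namespace Design

theorem isCont_zero : (zero r).IsCont tbar T :=
  ⟨continuousOn_const, continuousOn_const, continuousOn_const, continuousOn_const⟩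

theorem IsCont.perturb {Θ δ : Design r} (hΘ : Θ.IsCont tbar T) (hδ : δ.IsCont tbar T) (s : ℝ) :
    (Θ.perturb s δ).IsCont tbar T :=
  ⟨hΘ.1.add (hδ.1.const_smul s), hΘ.2.1.add (hδ.2.1.const_smul s),
    hΘ.2.2.1.add (hδ.2.2.1.const_smul s), hΘ.2.2.2.add (hδ.2.2.2.const_smul s)⟩

/-- The difference of two designs. -/
def diff (G H : Design r) : Design r where
  K := G.K - H.K
  b := G.b - H.b
  Kd := G.Kd - H.Kd
  bd := G.bd - H.bd

theorem IsCont.diff {G H : Design r} (hG : G.IsCont tbar T) (hH : H.IsCont tbar T) :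
    (G.diff H).IsCont tbar T :=
  ⟨hG.1.sub hH.1, hG.2.1.sub hH.2.1, hG.2.2.1.sub hH.2.2.1, hG.2.2.2.sub hH.2.2.2⟩

theorem IsCont.continuousOn_enc {G δ : Design r} (hG : G.IsCont tbar T) (hδ : δ.IsCont tbar T) :
    ContinuousOn (fun t => frob (G.K t) (δ.K t) + G.b t * δ.b t) (Icc 0 tbar) :=
  (continuousOn_frob hG.1 hδ.1).add (hG.2.1.mul hδ.2.1)

theorem IsCont.continuousOn_dec {G δ : Design r} (hG : G.IsCont tbar T) (hδ : δ.IsCont tbar T) :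
    ContinuousOn (fun t => frob (G.Kd t) (δ.Kd t) + G.bd t * δ.bd t) (Icc tbar T) :=
  (continuousOn_frob hG.2.2.1 hδ.2.2.1).add (hG.2.2.2.mul hδ.2.2.2)

theorem pairing_diff (h0 : 0 ≤ tbar) (hT : tbar ≤ T) {G H δ : Design r}
    (hG : G.IsCont tbar T) (hH : H.IsCont tbar T) (hδ : δ.IsCont tbar T) :
    (G.diff H).pairing tbar T δ = G.pairing tbar T δ - H.pairing tbar T δ := by
  have e := intervalIntegral.integral_sub (μ := MeasureTheory.volume)
    ((hG.continuousOn_enc hδ).intervalIntegrable_of_Icc h0)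
    ((hH.continuousOn_enc hδ).intervalIntegrable_of_Icc h0)
  have d := intervalIntegral.integral_sub (μ := MeasureTheory.volume)
    ((hG.continuousOn_dec hδ).intervalIntegrable_of_Icc hT)
    ((hH.continuousOn_dec hδ).intervalIntegrable_of_Icc hT)
  have : (G.diff H).pairing tbar T δ =
      (∫ t in (0 : ℝ)..tbar, (frob (G.K t) (δ.K t) + G.b t * δ.b t
        - (frob (H.K t) (δ.K t) + H.b t * δ.b t))) +
      ∫ t in tbar..T, (frob (G.Kd t) (δ.Kd t) + G.bd t * δ.bd t
        - (frob (H.Kd t) (δ.Kd t) + H.bd t * δ.bd t)) := by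
    simp only [pairing, diff, Pi.sub_apply, frob_sub_left]
    congr 1 <;> exact intervalIntegral.integral_congr fun t _ => by ring
  rw [this, e, d, pairing, pairing]
  ring

/-- The `L²` pairing is definite on continuous designs. -/
theorem eq_zero_of_pairing_self (h0 : 0 ≤ tbar) (hT : tbar ≤ T) {D : Design r}
    (hD : D.IsCont tbar T) (h : D.pairing tbar T D = 0) :
    (∀ t ∈ Ioo 0 tbar, D.K t = 0 ∧ D.b t = 0) ∧ ∀ t ∈ Ioo tbar T, D.Kd t = 0 ∧ D.bd t = 0 := by
  have he : ∀ t, 0 ≤ frob (D.K t) (D.K t) + D.b t * D.b t := fun t =>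
    add_nonneg (frob_self_nonneg _) (mul_self_nonneg _)
  have hd : ∀ t, 0 ≤ frob (D.Kd t) (D.Kd t) + D.bd t * D.bd t := fun t =>
    add_nonneg (frob_self_nonneg _) (mul_self_nonneg _)
  obtain ⟨Ie, Id⟩ := (add_eq_zero_iff_of_nonneg
    (intervalIntegral.integral_nonneg h0 fun t _ => he t)
    (intervalIntegral.integral_nonneg hT fun t _ => hd t)).1 h
  have split : ∀ (A : Weight r) (x : ℝ), frob A A + x * x = 0 → A = 0 ∧ x = 0 := fun A x hx =>
    have hx' := (add_eq_zero_iff_of_nonneg (frob_self_nonneg A) (mul_self_nonneg x)).1 hx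
    ⟨eq_zero_of_frob_self hx'.1, mul_self_eq_zero.1 hx'.2⟩
  exact ⟨fun t ht => split _ _ (eqOn_zero_of_integral_eq_zero_of_nonneg (ht.1.trans ht.2)
      (hD.continuousOn_enc hD) he Ie t (Ioo_subset_Icc_self ht)),
    fun t ht => split _ _ (eqOn_zero_of_integral_eq_zero_of_nonneg (ht.1.trans ht.2)
      (hD.continuousOn_dec hD) hd Id t (Ioo_subset_Icc_self ht))⟩

theorem pairing_eq_zero (h0 : 0 ≤ tbar) (hT : tbar ≤ T) {G : Design r}
    (he : ∀ t ∈ Ioo 0 tbar, G.K t = 0 ∧ G.b t = 0)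
    (hd : ∀ t ∈ Ioo tbar T, G.Kd t = 0 ∧ G.bd t = 0) (δ : Design r) :
    G.pairing tbar T δ = 0 := by
  rw [pairing, integral_congr_Ioo (k := fun _ => (0 : ℝ)) h0,
    integral_congr_Ioo (k := fun _ => (0 : ℝ)) hT]
  · simp
  · intro t ht
    simp [frob, hd t ht]
  · intro t ht
    simp [frob, he t ht]

end Design

/-- A continuous design gradient is unique on the open time intervals. -/
theorem HasDesignGradient.unique (h0 : 0 ≤ tbar) (hT : tbar ≤ T) {Φ : Design r → ℝ}
    {Θ G H : Design r} (hG : HasDesignGradient tbar T Φ Θ G)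
    (hH : HasDesignGradient tbar T Φ Θ H) :
    (∀ t ∈ Ioo 0 tbar, G.K t = H.K t ∧ G.b t = H.b t) ∧
      ∀ t ∈ Ioo tbar T, G.Kd t = H.Kd t ∧ G.bd t = H.bd t := by
  have hD := hG.1.diff hH.1
  have := Design.eq_zero_of_pairing_self h0 hT hD (by
    rw [Design.pairing_diff h0 hT hG.1 hH.1 hD, (hG.2 _ hD).unique (hH.2 _ hD), sub_self])
  simpa only [Design.diff, Pi.sub_apply, sub_eq_zero] using this

end DesignGradient

/-! ### First variations of the Lagrangians -/

namespace Problem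

variable {r c n : ℕ} {p : Problem r c n} {f g P Pd : Path r c n} {Θ : Design r}

theorem IsC1Pair.add_smul {u v δu δv : Path r c n} (h : p.IsC1Pair u v) (hδ : p.IsC1Pair δu δv)
    (s : ℝ) : p.IsC1Pair (u + s • δu) (v + s • δv) :=
  ⟨h.1.add (contDiffOn_const.smul hδ.1), h.2.add (contDiffOn_const.smul hδ.2)⟩

theorem continuousOn_encVel (h_enc : ContDiff ℝ 1 p.σ) (hf : p.IsC1Pair f g)
    (hΘ : Θ.IsCont p.tbar p.T) : ContinuousOn (p.encVel f Θ) (Icc 0 p.tbar) :=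
  continuousOn_pointwise h_enc.continuous (continuousOn_affine hΘ.1 hΘ.2.1 hf.1.continuousOn)

theorem continuousOn_decVel (h_dec : ContDiff ℝ 1 p.σd) (hf : p.IsC1Pair f g)
    (hΘ : Θ.IsCont p.tbar p.T) : ContinuousOn (p.decVel g Θ) (Icc p.tbar p.T) :=
  continuousOn_pointwise h_dec.continuous
    (continuousOn_affine hΘ.2.2.1 hΘ.2.2.2 hf.2.continuousOn)

theorem continuousOn_encVel' (h_enc : ContDiff ℝ 1 p.σ) (hf : p.IsC1Pair f g)
    (hΘ : Θ.IsCont p.tbar p.T) : ContinuousOn (p.encVel' f Θ) (Icc 0 p.tbar) :=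
  continuousOn_pointwise (h_enc.continuous_deriv le_rfl)
    (continuousOn_affine hΘ.1 hΘ.2.1 hf.1.continuousOn)

theorem continuousOn_decVel' (h_dec : ContDiff ℝ 1 p.σd) (hf : p.IsC1Pair f g)
    (hΘ : Θ.IsCont p.tbar p.T) : ContinuousOn (p.decVel' g Θ) (Icc p.tbar p.T) :=
  continuousOn_pointwise (h_dec.continuous_deriv le_rfl)
    (continuousOn_affine hΘ.2.2.1 hΘ.2.2.2 hf.2.continuousOn)

/-- The two Lagrangians differ by the multipliers tested against the violation of the initial and
of the coupling condition. All statements about `lagrangian` follow from this identity and the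
corresponding ones about `simplifiedLagrangian`. -/
theorem lagrangian_eq (h0 : 0 ≤ p.tbar) (hT : p.tbar ≤ p.T)
    (h_enc : ContDiff ℝ 1 p.σ) (h_dec : ContDiff ℝ 1 p.σd)
    (h_fg : p.IsC1Pair f g) (h_P : p.IsC1Pair P Pd) (hΘ : Θ.IsCont p.tbar p.T) :
    p.lagrangian f g Θ P Pd = p.simplifiedLagrangian f g Θ P Pd
      + inner ℝ (P 0) (p.xhat - f 0) + inner ℝ (Pd p.tbar) (f p.tbar - g p.tbar) := by
  rw [lagrangian, simplifiedLagrangian,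
    integral_inner_sub_eq h0 h_fg.1 h_P.1 (continuousOn_encVel h_enc h_fg hΘ),
    integral_inner_sub_eq hT h_fg.2 h_P.2 (continuousOn_decVel h_dec h_fg hΘ),
    inner_sub_right, inner_sub_right]
  ring

theorem IsAdmissible.lagrangian_eq (hadm : p.IsAdmissible f g) (h0 : 0 ≤ p.tbar)
    (hT : p.tbar ≤ p.T) (h_enc : ContDiff ℝ 1 p.σ) (h_dec : ContDiff ℝ 1 p.σd)
    (h_fg : p.IsC1Pair f g) (h_P : p.IsC1Pair P Pd) (hΘ : Θ.IsCont p.tbar p.T) :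
    p.lagrangian f g Θ P Pd = p.simplifiedLagrangian f g Θ P Pd := by
  rw [Problem.lagrangian_eq h0 hT h_enc h_dec h_fg h_P hΘ, hadm.1, hadm.2]
  simp

theorem hasDerivAt_simplifiedLagrangian_multiplier (h0 : 0 ≤ p.tbar) (hT : p.tbar ≤ p.T)
    (h_enc : ContDiff ℝ 1 p.σ) (h_dec : ContDiff ℝ 1 p.σd)
    (h_fg : p.IsC1Pair f g) (h_P : p.IsC1Pair P Pd) (hΘ : Θ.IsCont p.tbar p.T)
    {δP δPd : Path r c n} (hδ : p.IsC1Pair δP δPd) :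
    HasDerivAt (fun s : ℝ => p.simplifiedLagrangian f g Θ (P + s • δP) (Pd + s • δPd))
      ((∫ t in (0 : ℝ)..p.tbar,
          inner ℝ (derivWithin f (Icc 0 p.tbar) t - p.encVel f Θ t) (δP t))
        + (∫ t in p.tbar..p.T,
          inner ℝ (derivWithin g (Icc p.tbar p.T) t - p.decVel g Θ t) (δPd t))
        + inner ℝ (f 0 - p.xhat) (δP 0) + inner ℝ (g p.tbar - f p.tbar) (δPd p.tbar)) 0 := by
  -- In the form given by `lagrangian`, no derivative falls on the multipliers.
  have hrw : (fun s : ℝ => p.simplifiedLagrangian f g Θ (P + s • δP) (Pd + s • δPd)) =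
      fun s : ℝ => p.lagrangian f g Θ (P + s • δP) (Pd + s • δPd)
        + inner ℝ (f 0 - p.xhat) (P 0 + s • δP 0)
        + inner ℝ (g p.tbar - f p.tbar) (Pd p.tbar + s • δPd p.tbar) := by
    funext s
    rw [lagrangian_eq h0 hT h_enc h_dec h_fg (h_P.add_smul hδ s) hΘ, ← neg_sub p.xhat,
      ← neg_sub (f p.tbar), inner_neg_left, inner_neg_left,
      real_inner_comm _ (p.xhat - f 0), real_inner_comm _ (f p.tbar - g p.tbar)]
    simp only [Pi.add_apply, Pi.smul_apply]
    ring
  rw [hrw]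
  have e := hasDerivAt_integral_inner_add_smul h0
    ((continuousOn_derivWithin_Icc h0 h_fg.1).sub (continuousOn_encVel h_enc h_fg hΘ))
    h_P.1.continuousOn hδ.1.continuousOn
  have d := hasDerivAt_integral_inner_add_smul hT
    ((continuousOn_derivWithin_Icc hT h_fg.2).sub (continuousOn_decVel h_dec h_fg hΘ))
    h_P.2.continuousOn hδ.2.continuousOn
  have := (((e.const_add (p.cost Θ (g p.T))).add d).add
    (hasDerivAt_inner_add_smul (f 0 - p.xhat) (P 0) (δP 0))).add
    (hasDerivAt_inner_add_smul (g p.tbar - f p.tbar) (Pd p.tbar) (δPd p.tbar))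
  exact this

/-- The right-hand side of the adjoint equation of the encoder. -/
noncomputable def encAdj (p : Problem r c n) (f : Path r c n) (Θ : Design r) (P : Path r c n)
    (t : ℝ) : Tensor r c n :=
  -act (Θ.K t).transpose (hadamard (P t) (p.encVel' f Θ t))

/-- The right-hand side of the adjoint equation of the decoder. -/
noncomputable def decAdj (p : Problem r c n) (g : Path r c n) (Θ : Design r) (Pd : Path r c n)
    (t : ℝ) : Tensor r c n :=
  -act (Θ.Kd t).transpose (hadamard (Pd t) (p.decVel' g Θ t))

theorem continuousOn_encAdj (h_enc : ContDiff ℝ 1 p.σ) (h_fg : p.IsC1Pair f g)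
    (h_P : p.IsC1Pair P Pd) (hΘ : Θ.IsCont p.tbar p.T) :
    ContinuousOn (p.encAdj f Θ P) (Icc 0 p.tbar) :=
  (continuousOn_act (continuousOn_transpose hΘ.1) (continuousOn_hadamard h_P.1.continuousOn
    (continuousOn_encVel' h_enc h_fg hΘ))).neg

theorem continuousOn_decAdj (h_dec : ContDiff ℝ 1 p.σd) (h_fg : p.IsC1Pair f g)
    (h_P : p.IsC1Pair P Pd) (hΘ : Θ.IsCont p.tbar p.T) :
    ContinuousOn (p.decAdj g Θ Pd) (Icc p.tbar p.T) :=
  (continuousOn_act (continuousOn_transpose hΘ.2.2.1) (continuousOn_hadamard h_P.2.continuousOn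
    (continuousOn_decVel' h_dec h_fg hΘ))).neg

/-- The first variation of the simplified Lagrangian in the states: the residuals of the adjoint
equations and of their boundary conditions, tested against the direction. -/
noncomputable def stateVariation (p : Problem r c n) (f g : Path r c n) (Θ : Design r)
    (P Pd δf δg : Path r c n) : ℝ :=
  -(∫ t in (0 : ℝ)..p.tbar,
      inner ℝ (derivWithin P (Icc 0 p.tbar) t - p.encAdj f Θ P t) (δf t))
    - (∫ t in p.tbar..p.T,
      inner ℝ (derivWithin Pd (Icc p.tbar p.T) t - p.decAdj g Θ Pd t) (δg t))
    + inner ℝ (P p.tbar - Pd p.tbar) (δf p.tbar)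
    + inner ℝ (Pd p.T + gradient (p.J p.x) (g p.T)) (δg p.T)

theorem hasDerivAt_simplifiedLagrangian_state (h0 : 0 ≤ p.tbar) (hT : p.tbar ≤ p.T)
    (h_enc : ContDiff ℝ 1 p.σ) (h_dec : ContDiff ℝ 1 p.σd)
    (h_fg : p.IsC1Pair f g) (h_P : p.IsC1Pair P Pd) (hΘ : Θ.IsCont p.tbar p.T)
    (h_J : DifferentiableAt ℝ (p.J p.x) (g p.T))
    {δf δg : Path r c n} (hδ : p.IsC1Pair δf δg) :
    HasDerivAt (fun s : ℝ => p.simplifiedLagrangian (f + s • δf) (g + s • δg) Θ P Pd)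
      (p.stateVariation f g Θ P Pd δf δg) 0 := by
  have hJ : HasDerivAt (fun s : ℝ => p.cost Θ ((g + s • δg) p.T))
      (inner ℝ (gradient (p.J p.x) (g p.T)) (δg p.T)) 0 := by
    have hline : HasDerivAt (fun s : ℝ => g p.T + s • δg p.T) (δg p.T) 0 := by
      simpa using ((hasDerivAt_id (0 : ℝ)).smul_const (δg p.T)).const_add (g p.T)
    have hgr := h_J.hasGradientAt.hasFDerivAt
    rw [show g p.T = g p.T + (0 : ℝ) • δg p.T by simp] at hgr
    have := hgr.comp_hasDerivAt (0 : ℝ) hline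
    simpa [cost] using! this.add_const (p.R Θ)
  have e1 := hasDerivAt_integral_inner_add_smul h0 (continuousOn_derivWithin_Icc h0 h_P.1)
    h_fg.1.continuousOn hδ.1.continuousOn
  have d1 := hasDerivAt_integral_inner_add_smul hT (continuousOn_derivWithin_Icc hT h_P.2)
    h_fg.2.continuousOn hδ.2.continuousOn
  have e2 := hasDerivAt_integral_velocity_state h0 h_enc hΘ.1 hΘ.2.1 h_P.1.continuousOn
    h_fg.1.continuousOn hδ.1.continuousOn
  have d2 := hasDerivAt_integral_velocity_state hT h_dec hΘ.2.2.1 hΘ.2.2.2 h_P.2.continuousOn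
    h_fg.2.continuousOn hδ.2.continuousOn
  have b1 := hasDerivAt_inner_add_smul (P p.tbar) (f p.tbar) (δf p.tbar)
  have b2 := hasDerivAt_inner_add_smul (Pd p.T) (g p.T) (δg p.T)
  have b3 := hasDerivAt_inner_add_smul (Pd p.tbar) (f p.tbar) (δf p.tbar)
  have key := (((((((hJ.sub e1).add b1).sub_const (inner ℝ (P 0) p.xhat)).sub e2).sub d1).add
    b2).sub b3).sub d2
  refine HasDerivAt.congr_deriv key ?_
  have split : ∀ {a b : ℝ} (_ : a ≤ b) {u w δ : Path r c n} (_ : ContDiffOn ℝ 1 u (Icc a b))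
      (_ : ContinuousOn w (Icc a b)) (_ : ContDiffOn ℝ 1 δ (Icc a b)),
      ∫ t in a..b, inner ℝ (derivWithin u (Icc a b) t - -w t) (δ t) =
        (∫ t in a..b, inner ℝ (derivWithin u (Icc a b) t) (δ t))
          + ∫ t in a..b, inner ℝ (w t) (δ t) := by
    intro a b hab u w δ hu hw hδ
    simp only [sub_neg_eq_add, inner_add_left]
    exact intervalIntegral.integral_add
      (((continuousOn_derivWithin_Icc hab hu).inner hδ.continuousOn).intervalIntegrable_of_Icc hab)
      ((hw.inner hδ.continuousOn).intervalIntegrable_of_Icc hab)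
  have s1 := split h0 h_P.1 (continuousOn_encAdj h_enc h_fg h_P hΘ).neg hδ.1
  have s2 := split hT h_P.2 (continuousOn_decAdj h_dec h_fg h_P hΘ).neg hδ.2
  simp only [Pi.neg_apply, neg_neg] at s1 s2
  rw [stateVariation, s1, s2]
  simp only [encAdj, decAdj, neg_neg, inner_sub_left, inner_add_left, encVel', decVel']
  ring

/-- The design gradient common to both Lagrangians: minus the transposed derivative of the velocities,
applied to the multipliers, plus the gradient `ρ` of the regularizer. -/
noncomputable def designGradient (p : Problem r c n) (f g : Path r c n) (Θ : Design r)
    (P Pd : Path r c n) (ρ : Design r) : Design r where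
  K t := -mulTranspose (hadamard (P t) (p.encVel' f Θ t)) (f t) + ρ.K t
  b t := -inner ℝ (p.encVel' f Θ t) (P t) + ρ.b t
  Kd t := -mulTranspose (hadamard (Pd t) (p.decVel' g Θ t)) (g t) + ρ.Kd t
  bd t := -inner ℝ (p.decVel' g Θ t) (Pd t) + ρ.bd t

theorem hasDesignGradient_simplifiedLagrangian (h0 : 0 ≤ p.tbar) (hT : p.tbar ≤ p.T)
    (h_enc : ContDiff ℝ 1 p.σ) (h_dec : ContDiff ℝ 1 p.σd)
    (h_fg : p.IsC1Pair f g) (h_P : p.IsC1Pair P Pd) (hΘ : Θ.IsCont p.tbar p.T) {ρ : Design r}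
    (h_R : HasDesignGradient p.tbar p.T p.R Θ ρ) :
    HasDesignGradient p.tbar p.T (fun Θ' => p.simplifiedLagrangian f g Θ' P Pd) Θ
      (p.designGradient f g Θ P Pd ρ) := by
  have ce := continuousOn_encVel' h_enc h_fg hΘ
  have cd := continuousOn_decVel' h_dec h_fg hΘ
  -- The contribution of the velocity terms, as a design.
  let V : Design r :=
    { K := fun t => mulTranspose (hadamard (P t) (p.encVel' f Θ t)) (f t)
      b := fun t => inner ℝ (p.encVel' f Θ t) (P t)
      Kd := fun t => mulTranspose (hadamard (Pd t) (p.decVel' g Θ t)) (g t)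
      bd := fun t => inner ℝ (p.decVel' g Θ t) (Pd t) }
  have hV : V.IsCont p.tbar p.T :=
    ⟨continuousOn_mulTranspose (continuousOn_hadamard h_P.1.continuousOn ce) h_fg.1.continuousOn,
      ce.inner h_P.1.continuousOn,
      continuousOn_mulTranspose (continuousOn_hadamard h_P.2.continuousOn cd) h_fg.2.continuousOn,
      cd.inner h_P.2.continuousOn⟩
  have hG : p.designGradient f g Θ P Pd ρ = ρ.diff V := by
    simp only [designGradient, Design.diff, V, neg_add_eq_sub]
    rfl
  rw [hG]
  refine ⟨h_R.1.diff hV, fun δ hδ => ?_⟩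
  rw [Design.pairing_diff h0 hT h_R.1 hV hδ]
  have e := hasDerivAt_integral_velocity_design h0 h_enc hΘ.1 hΘ.2.1 hδ.1 hδ.2.1
    h_P.1.continuousOn h_fg.1.continuousOn
  have d := hasDerivAt_integral_velocity_design hT h_dec hΘ.2.2.1 hΘ.2.2.2 hδ.2.2.1 hδ.2.2.2
    h_P.2.continuousOn h_fg.2.continuousOn
  have key := ((((((((h_R.2 δ hδ).const_add (p.J p.x (g p.T))).sub_const
    (∫ t in (0 : ℝ)..p.tbar, inner ℝ (derivWithin P (Icc 0 p.tbar) t) (f t))).add_const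
    (inner ℝ (P p.tbar) (f p.tbar))).sub_const (inner ℝ (P 0) p.xhat)).sub e).sub_const
    (∫ t in p.tbar..p.T, inner ℝ (derivWithin Pd (Icc p.tbar p.T) t) (g t))).add_const
    (inner ℝ (Pd p.T) (g p.T))).sub_const (inner ℝ (Pd p.tbar) (f p.tbar)) |>.sub d
  refine HasDerivAt.congr_deriv key ?_
  rw [sub_sub]
  rfl

theorem hasDesignGradient_lagrangian_iff (h0 : 0 ≤ p.tbar) (hT : p.tbar ≤ p.T)
    (h_enc : ContDiff ℝ 1 p.σ) (h_dec : ContDiff ℝ 1 p.σd)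
    (h_fg : p.IsC1Pair f g) (h_P : p.IsC1Pair P Pd) (hΘ : Θ.IsCont p.tbar p.T) {G : Design r} :
    HasDesignGradient p.tbar p.T (fun Θ' => p.lagrangian f g Θ' P Pd) Θ G ↔
      HasDesignGradient p.tbar p.T (fun Θ' => p.simplifiedLagrangian f g Θ' P Pd) Θ G := by
  refine and_congr_right fun _ => forall₂_congr fun δ hδ => ?_
  simp only [fun s => lagrangian_eq h0 hT h_enc h_dec h_fg h_P (hΘ.perturb hδ s),
    hasDerivAt_add_const_iff]

/-- Design stationarity means that zero is a design gradient, so uniqueness applies to it. -/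
theorem designStationary_iff (h0 : 0 ≤ p.tbar) (hT : p.tbar ≤ p.T) {L : Functional r c n} :
    p.DesignStationary L f g Θ P Pd ↔
      HasDesignGradient p.tbar p.T (fun Θ' => L f g Θ' P Pd) Θ (Design.zero r) := by
  simp only [DesignStationary, HasDesignGradient, Design.isCont_zero, true_and,
    Design.pairing_eq_zero h0 hT (G := Design.zero r) (fun _ _ => ⟨rfl, rfl⟩)
      (fun _ _ => ⟨rfl, rfl⟩)]

theorem designEq_iff {ρ G : Design r} : p.DesignEq f g Θ P Pd ρ G ↔
    (∀ t ∈ Ioo 0 p.tbar, G.K t = (p.designGradient f g Θ P Pd ρ).K t ∧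
        G.b t = (p.designGradient f g Θ P Pd ρ).b t) ∧
      ∀ t ∈ Ioo p.tbar p.T, G.Kd t = (p.designGradient f g Θ P Pd ρ).Kd t ∧
        G.bd t = (p.designGradient f g Θ P Pd ρ).bd t := by
  simp only [DesignEq, designGradient, forall_and, and_assoc]

/-- The design assertions for any functional that has `designGradient` as a design gradient. -/
theorem designEq_of_hasDesignGradient (h0 : 0 ≤ p.tbar) (hT : p.tbar ≤ p.T)
    {L : Functional r c n} {ρ : Design r}
    (hL : HasDesignGradient p.tbar p.T (fun Θ' => L f g Θ' P Pd) Θ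
      (p.designGradient f g Θ P Pd ρ)) :
    (∃ G, HasDesignGradient p.tbar p.T (fun Θ' => L f g Θ' P Pd) Θ G) ∧
      (∀ G, HasDesignGradient p.tbar p.T (fun Θ' => L f g Θ' P Pd) Θ G →
        p.DesignEq f g Θ P Pd ρ G) ∧
      (p.DesignStationary L f g Θ P Pd ↔ p.DesignEq f g Θ P Pd ρ (Design.zero r)) := by
  have huniq : ∀ G, HasDesignGradient p.tbar p.T (fun Θ' => L f g Θ' P Pd) Θ G →
      p.DesignEq f g Θ P Pd ρ G := fun G hG => designEq_iff.2 (hG.unique h0 hT hL)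
  refine ⟨⟨_, hL⟩, huniq, fun h => huniq _ ((designStationary_iff h0 hT).1 h), fun h δ hδ => ?_⟩
  obtain ⟨he, hd⟩ := designEq_iff.1 h
  exact (hL.2 δ hδ).congr_deriv (Design.pairing_eq_zero h0 hT
    (fun t ht => ⟨(he t ht).1.symm, (he t ht).2.symm⟩)
    (fun t ht => ⟨(hd t ht).1.symm, (hd t ht).2.symm⟩) δ)

/-! ### State equations -/

theorem multiplierStationary_simplifiedLagrangian_iff (h0 : 0 < p.tbar) (hT : p.tbar ≤ p.T)
    (h_enc : ContDiff ℝ 1 p.σ) (h_dec : ContDiff ℝ 1 p.σd)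
    (h_fg : p.IsC1Pair f g) (h_P : p.IsC1Pair P Pd) (hΘ : Θ.IsCont p.tbar p.T) :
    p.MultiplierStationary p.simplifiedLagrangian f g Θ P Pd ↔ p.StateEq f g Θ := by
  constructor
  · intro h
    have hvar := fun (δP δPd : Path r c n) (hδ : p.IsC1Pair δP δPd) =>
      (hasDerivAt_simplifiedLagrangian_multiplier h0.le hT h_enc h_dec h_fg h_P hΘ hδ).unique
        (h δP δPd hδ)
    have hf : ∀ t ∈ Icc 0 p.tbar, HasDerivWithinAt f (p.encVel f Θ t) (Icc 0 p.tbar) t := by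
      refine hasDerivWithinAt_of_weak h0 h_fg.1 (continuousOn_encVel h_enc h_fg hΘ) ?_
      intro φ hφ hφ0 _
      simpa [hφ0] using hvar φ 0 ⟨hφ.contDiffOn, contDiffOn_const⟩
    have hg : ∀ t ∈ Ioc p.tbar p.T,
        HasDerivWithinAt g (p.decVel g Θ t) (Icc p.tbar p.T) t := by
      intro t ht
      refine hasDerivWithinAt_of_weak (ht.1.trans_le ht.2) h_fg.2
        (continuousOn_decVel h_dec h_fg hΘ) ?_ t (Ioc_subset_Icc_self ht)
      intro φ hφ hφ0 _
      simpa [hφ0] using hvar 0 φ ⟨contDiffOn_const, hφ.contDiffOn⟩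
    have Ie := integral_inner_derivWithin_sub_eq_zero h0.le
      fun t ht => hf t (Ioo_subset_Icc_self ht)
    have Id := integral_inner_derivWithin_sub_eq_zero hT
      fun t ht => hg t (Ioo_subset_Ioc_self ht)
    refine ⟨fun t ht => hf t (Ioc_subset_Icc_self ht), ?_, hg, ?_⟩
    -- Constant test multipliers recover the initial and the coupling condition.
    · have := hvar (fun _ => f 0 - p.xhat) 0 ⟨contDiffOn_const, contDiffOn_const⟩
      rw [Ie, Id] at this
      simpa [sub_eq_zero] using this
    · have := hvar 0 (fun _ => g p.tbar - f p.tbar) ⟨contDiffOn_const, contDiffOn_const⟩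
      rw [Ie, Id] at this
      simpa [sub_eq_zero] using this
  · rintro ⟨hf, hi, hg, hc⟩ δP δPd hδ
    refine (hasDerivAt_simplifiedLagrangian_multiplier h0.le hT h_enc h_dec h_fg h_P hΘ
      hδ).congr_deriv ?_
    rw [integral_inner_derivWithin_sub_eq_zero h0.le
        fun t ht => hf t (Ioo_subset_Ioc_self ht),
      integral_inner_derivWithin_sub_eq_zero hT fun t ht => hg t (Ioo_subset_Ioc_self ht), hi, hc]
    simp

theorem multiplierStationary_lagrangian_iff (h0 : 0 < p.tbar) (hT : p.tbar ≤ p.T)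
    (h_enc : ContDiff ℝ 1 p.σ) (h_dec : ContDiff ℝ 1 p.σd)
    (h_fg : p.IsC1Pair f g) (h_P : p.IsC1Pair P Pd) (hΘ : Θ.IsCont p.tbar p.T) :
    p.IsAdmissible f g ∧ p.MultiplierStationary p.lagrangian f g Θ P Pd ↔ p.StateEq f g Θ := by
  have hiff : p.IsAdmissible f g → (p.MultiplierStationary p.lagrangian f g Θ P Pd ↔
      p.MultiplierStationary p.simplifiedLagrangian f g Θ P Pd) := fun hadm =>
    forall₃_congr fun δP δPd hδ => by
      simp only [fun s => hadm.lagrangian_eq h0.le hT h_enc h_dec h_fg (h_P.add_smul hδ s) hΘ]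
  rw [← multiplierStationary_simplifiedLagrangian_iff h0 hT h_enc h_dec h_fg h_P hΘ]
  refine ⟨fun h => (hiff h.1).1 h.2, fun h => ?_⟩
  have hs := (multiplierStationary_simplifiedLagrangian_iff h0 hT h_enc h_dec h_fg h_P hΘ).1 h
  have hadm : p.IsAdmissible f g := ⟨hs.2.1, hs.2.2.2⟩
  exact ⟨hadm, (hiff hadm).2 h⟩

/-! ### Adjoint equations -/

/-- Along solutions of the two adjoint differential equations, only the boundary terms of the
first variation in the states remain. -/
theorem stateVariation_of_adjoint_ode (h0 : 0 ≤ p.tbar) (hT : p.tbar ≤ p.T)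
    (hP : ∀ t ∈ Ioo 0 p.tbar, HasDerivWithinAt P (p.encAdj f Θ P t) (Icc 0 p.tbar) t)
    (hPd : ∀ t ∈ Ioo p.tbar p.T, HasDerivWithinAt Pd (p.decAdj g Θ Pd t) (Icc p.tbar p.T) t)
    (δf δg : Path r c n) :
    p.stateVariation f g Θ P Pd δf δg = inner ℝ (P p.tbar - Pd p.tbar) (δf p.tbar)
      + inner ℝ (Pd p.T + gradient (p.J p.x) (g p.T)) (δg p.T) := by
  rw [stateVariation, integral_inner_derivWithin_sub_eq_zero h0 hP,
    integral_inner_derivWithin_sub_eq_zero hT hPd]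
  ring

theorem AdjointEq.stateVariation_eq_zero (h : p.AdjointEq f g Θ P Pd) (h0 : 0 ≤ p.tbar)
    (hT : p.tbar ≤ p.T) (δf δg : Path r c n) : p.stateVariation f g Θ P Pd δf δg = 0 := by
  obtain ⟨hP, hc, hPd, hJ⟩ := h
  rw [stateVariation_of_adjoint_ode h0 hT (fun t ht => hP t (Ioo_subset_Ico_self ht))
    (fun t ht => hPd t (Ioo_subset_Ico_self ht)), hc, hJ]
  simp

/-- Variations that vanish at `0`, `tbar` and `T` suffice for the adjoint differential
equations. -/
theorem adjoint_ode_of_stateVariation (h0 : 0 < p.tbar)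
    (h_enc : ContDiff ℝ 1 p.σ) (h_dec : ContDiff ℝ 1 p.σd)
    (h_fg : p.IsC1Pair f g) (h_P : p.IsC1Pair P Pd) (hΘ : Θ.IsCont p.tbar p.T)
    (h : ∀ δf δg : Path r c n, p.IsC1Pair δf δg → δf 0 = 0 → δg p.tbar = δf p.tbar →
      p.stateVariation f g Θ P Pd δf δg = 0) :
    (∀ t ∈ Ico 0 p.tbar, HasDerivWithinAt P (p.encAdj f Θ P t) (Icc 0 p.tbar) t) ∧
      ∀ t ∈ Ico p.tbar p.T, HasDerivWithinAt Pd (p.decAdj g Θ Pd t) (Icc p.tbar p.T) t := by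
  constructor
  · intro t ht
    refine hasDerivWithinAt_of_weak h0 h_P.1 (continuousOn_encAdj h_enc h_fg h_P hΘ) ?_ t
      (Ico_subset_Icc_self ht)
    intro φ hφ hφ0 hφ1
    simpa [stateVariation, hφ1] using
      h φ 0 ⟨hφ.contDiffOn, contDiffOn_const⟩ hφ0 (by simp [hφ1])
  · intro t ht
    refine hasDerivWithinAt_of_weak (ht.1.trans_lt ht.2) h_P.2
      (continuousOn_decAdj h_dec h_fg h_P hΘ) ?_ t (Ico_subset_Icc_self ht)
    intro φ hφ hφ0 hφ1
    simpa [stateVariation, hφ1] using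
      h 0 φ ⟨contDiffOn_const, hφ.contDiffOn⟩ rfl (by simp [hφ0])

theorem stateStationary_simplifiedLagrangian_iff (h0 : 0 < p.tbar) (hT : p.tbar ≤ p.T)
    (h_enc : ContDiff ℝ 1 p.σ) (h_dec : ContDiff ℝ 1 p.σd)
    (h_fg : p.IsC1Pair f g) (h_P : p.IsC1Pair P Pd) (hΘ : Θ.IsCont p.tbar p.T)
    (h_J : DifferentiableAt ℝ (p.J p.x) (g p.T)) :
    p.StateStationary p.simplifiedLagrangian f g Θ P Pd ↔ p.AdjointEq f g Θ P Pd := by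
  have hder := fun (δf δg : Path r c n) (hδ : p.IsC1Pair δf δg) =>
    hasDerivAt_simplifiedLagrangian_state h0.le hT h_enc h_dec h_fg h_P hΘ h_J hδ
  constructor
  · intro h
    have hvar := fun δf δg hδ => (hder δf δg hδ).unique (h δf δg hδ)
    obtain ⟨hP, hPd⟩ := adjoint_ode_of_stateVariation h0 h_enc h_dec h_fg h_P hΘ
      fun δf δg hδ _ _ => hvar δf δg hδ
    have hb := stateVariation_of_adjoint_ode h0.le hT
      (fun t ht => hP t (Ioo_subset_Ico_self ht)) (fun t ht => hPd t (Ioo_subset_Ico_self ht))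
    refine ⟨hP, ?_, hPd, ?_⟩
    · have := hvar (fun _ => P p.tbar - Pd p.tbar) 0 ⟨contDiffOn_const, contDiffOn_const⟩
      rw [hb] at this
      simpa [sub_eq_zero] using this
    · have := hvar 0 (fun _ => Pd p.T + gradient (p.J p.x) (g p.T))
        ⟨contDiffOn_const, contDiffOn_const⟩
      rw [hb] at this
      simpa [add_eq_zero_iff_eq_neg] using this
  · intro h δf δg hδ
    exact (hder δf δg hδ).congr_deriv (h.stateVariation_eq_zero h0.le hT δf δg)

/-- Affine variations between prescribed boundary values recover the boundary conditions. If
`tbar = T`, the decoder integral is absent and only the sum of the two boundary residuals is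
tested, so the coupling of the multipliers has to be assumed. -/
theorem adjointEq_of_stateVariation (h0 : 0 < p.tbar) (hT : p.tbar ≤ p.T)
    (h_enc : ContDiff ℝ 1 p.σ) (h_dec : ContDiff ℝ 1 p.σd)
    (h_fg : p.IsC1Pair f g) (h_P : p.IsC1Pair P Pd) (hΘ : Θ.IsCont p.tbar p.T)
    (hconv : p.tbar = p.T → Pd p.T = P p.T)
    (h : ∀ δf δg : Path r c n, p.IsC1Pair δf δg → δf 0 = 0 → δg p.tbar = δf p.tbar →
      p.stateVariation f g Θ P Pd δf δg = 0) : p.AdjointEq f g Θ P Pd := by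
  obtain ⟨hP, hPd⟩ := adjoint_ode_of_stateVariation h0 h_enc h_dec h_fg h_P hΘ h
  have hb := stateVariation_of_adjoint_ode h0.le hT
    (fun t ht => hP t (Ioo_subset_Ico_self ht)) (fun t ht => hPd t (Ioo_subset_Ico_self ht))
  have hlin : ∀ (α β : ℝ) (v : Tensor r c n), ContDiff ℝ 1 fun t : ℝ => ((t - α) / β) • v :=
    fun α β v => ((contDiff_id.sub contDiff_const).div_const β).smul contDiff_const
  have h0' : p.tbar ≠ 0 := h0.ne'
  suffices hbc : P p.tbar = Pd p.tbar ∧ Pd p.T + gradient (p.J p.x) (g p.T) = 0 from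
    ⟨hP, hbc.1, hPd, add_eq_zero_iff_eq_neg.1 hbc.2⟩
  rcases hT.eq_or_lt with heq | hlt
  · have hc : P p.tbar = Pd p.tbar := by rw [heq, hconv heq]
    refine ⟨hc, ?_⟩
    set v := Pd p.T + gradient (p.J p.x) (g p.T)
    have := h (fun t => ((t - 0) / p.tbar) • v) (fun t => ((t - 0) / p.tbar) • v)
      ⟨(hlin _ _ _).contDiffOn, (hlin _ _ _).contDiffOn⟩ (by simp) rfl
    rw [hb, hc, ← heq] at this
    simpa [h0'] using this
  · have hne : p.T - p.tbar ≠ 0 := (sub_pos.2 hlt).ne'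
    have hne' : p.tbar - p.T ≠ 0 := (sub_neg.2 hlt).ne
    constructor
    · have := h (fun t => ((t - 0) / p.tbar) • (P p.tbar - Pd p.tbar))
        (fun t => ((t - p.T) / (p.tbar - p.T)) • (P p.tbar - Pd p.tbar))
        ⟨(hlin _ _ _).contDiffOn, (hlin _ _ _).contDiffOn⟩ (by simp) (by simp [h0', hne'])
      rw [hb] at this
      simpa [h0', sub_eq_zero] using this
    · set v := Pd p.T + gradient (p.J p.x) (g p.T)
      have := h 0 (fun t => ((t - p.tbar) / (p.T - p.tbar)) • v)
        ⟨contDiffOn_const, (hlin _ _ _).contDiffOn⟩ rfl (by simp)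
      rw [hb] at this
      simpa [hne] using this

theorem constrainedStateStationary_lagrangian_iff (h0 : 0 < p.tbar) (hT : p.tbar ≤ p.T)
    (h_enc : ContDiff ℝ 1 p.σ) (h_dec : ContDiff ℝ 1 p.σd)
    (h_fg : p.IsC1Pair f g) (h_P : p.IsC1Pair P Pd) (hΘ : Θ.IsCont p.tbar p.T)
    (h_J : DifferentiableAt ℝ (p.J p.x) (g p.T)) (hconv : p.tbar = p.T → Pd p.T = P p.T) :
    p.ConstrainedStateStationary p.lagrangian f g Θ P Pd ↔ p.AdjointEq f g Θ P Pd := by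
  -- Along constrained variations the violations of the side conditions stay constant.
  have hder : ∀ δf δg : Path r c n, p.IsC1Pair δf δg → δf 0 = 0 → δg p.tbar = δf p.tbar →
      HasDerivAt (fun s : ℝ => p.lagrangian (f + s • δf) (g + s • δg) Θ P Pd)
        (p.stateVariation f g Θ P Pd δf δg) 0 := by
    intro δf δg hδ hi hc
    simp only [fun s => lagrangian_eq h0.le hT h_enc h_dec (h_fg.add_smul hδ s) h_P hΘ,
      Pi.add_apply, Pi.smul_apply, hi, hc, smul_zero, add_zero, add_sub_add_right_eq_sub,
      hasDerivAt_add_const_iff]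
    exact hasDerivAt_simplifiedLagrangian_state h0.le hT h_enc h_dec h_fg h_P hΘ h_J hδ
  constructor
  · intro h
    exact adjointEq_of_stateVariation h0 hT h_enc h_dec h_fg h_P hΘ hconv
      fun δf δg hδ hi hc => (hder δf δg hδ hi hc).unique (h δf δg hδ hi hc)
  · intro h δf δg hδ hi hc
    exact (hder δf δg hδ hi hc).congr_deriv (h.stateVariation_eq_zero h0.le hT δf δg)

end Problem

end ContAE

open ContAE.Problem

theorem mainTheorem1 {r c n : ℕ} (p : ContAE.Problem r c n)
    (h_tbar : 0 < p.tbar) (h_T : p.tbar ≤ p.T)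
    (h_enc : ContDiff ℝ 1 p.σ) (h_dec : ContDiff ℝ 1 p.σd)
    (f g P Pd : ContAE.Path r c n) (Θ ρ : ContAE.Design r)
    (h_fg : p.IsC1Pair f g) (h_PPd : p.IsC1Pair P Pd) (h_Θ : Θ.IsCont p.tbar p.T)
    (h_J : DifferentiableAt ℝ (p.J p.x) (g p.T))
    (h_R : ContAE.HasDesignGradient p.tbar p.T p.R Θ ρ) :
    -- the two forms of the Lagrangian agree
    (p.IsAdmissible f g → p.lagrangian f g Θ P Pd = p.simplifiedLagrangian f g Θ P Pd) ∧
    -- (A)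
    (p.MultiplierStationary p.simplifiedLagrangian f g Θ P Pd ↔ p.StateEq f g Θ) ∧
    (p.IsAdmissible f g ∧ p.MultiplierStationary p.lagrangian f g Θ P Pd ↔ p.StateEq f g Θ) ∧
    -- (B)
    (p.StateStationary p.simplifiedLagrangian f g Θ P Pd ↔ p.AdjointEq f g Θ P Pd) ∧
    ((p.tbar = p.T → Pd p.T = P p.T) →
      (p.ConstrainedStateStationary p.lagrangian f g Θ P Pd ↔ p.AdjointEq f g Θ P Pd)) ∧
    -- (C)
    (∀ L : ContAE.Functional r c n, L = p.lagrangian ∨ L = p.simplifiedLagrangian →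
      (∃ G, ContAE.HasDesignGradient p.tbar p.T (fun Θ' => L f g Θ' P Pd) Θ G) ∧
      (∀ G, ContAE.HasDesignGradient p.tbar p.T (fun Θ' => L f g Θ' P Pd) Θ G →
        p.DesignEq f g Θ P Pd ρ G) ∧
      (p.DesignStationary L f g Θ P Pd ↔
        p.DesignEq f g Θ P Pd ρ (ContAE.Design.zero r))) := by
  have h0 := h_tbar.le
  refine ⟨fun hadm => hadm.lagrangian_eq h0 h_T h_enc h_dec h_fg h_PPd h_Θ,
    multiplierStationary_simplifiedLagrangian_iff h_tbar h_T h_enc h_dec h_fg h_PPd h_Θ,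
    multiplierStationary_lagrangian_iff h_tbar h_T h_enc h_dec h_fg h_PPd h_Θ,
    stateStationary_simplifiedLagrangian_iff h_tbar h_T h_enc h_dec h_fg h_PPd h_Θ h_J,
    constrainedStateStationary_lagrangian_iff h_tbar h_T h_enc h_dec h_fg h_PPd h_Θ h_J, ?_⟩
  have hs := hasDesignGradient_simplifiedLagrangian h0 h_T h_enc h_dec h_fg h_PPd h_Θ h_R
  rintro L (rfl | rfl)
  · exact designEq_of_hasDesignGradient h0 h_T
      ((hasDesignGradient_lagrangian_iff h0 h_T h_enc h_dec h_fg h_PPd h_Θ).2 hs)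
  · exact designEq_of_hasDesignGradient h0 h_T hs
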